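/- Let $L$ be a first-order language, let $\kappa>|L|+\aleph_0$ be a cardinal and let $\mathcal U$ be a $\kappa$-saturated $L$-structure (the monster model; "small" means of cardinality $<\kappa$; for a saturated $\mathcal U$ one may take $\kappa=|\mathcal U|$). For $A\subseteq\mathcal U$ and a tuple of variables $x$, a Keisler measure over $A$ in $x$ is a finitely additive probability measure on the Boolean algebra of $A$-definable subsets of $\mathcal U^{x}$; it is global if $A=\mathcal U$. A Keisler measure $\mu$ over a small elementary submodel $M\prec\mathcal U$ is smooth if it has a unique extension to a global Keisler measure. If $M\prec\mathcal U$ is not necessarily small, $\mu$ over $M$ is called smooth if it has a unique global extension and, moreover, its restriction to some small $M_0\prec\mathcal U$ with $M_0\subseteq M$ already has a unique global extension (for small $M$ the two definitions agree). If $\mu_x,\nu_y,\omega_{xy}$ are Keisler measures over $M$, then $\omega$ is a separated amalgam of $\mu$ and $\nu$ if $\omega(\varphi(x)\wedge\psi(y))=\mu(\varphi(x))\,\nu(\psi(y))$ for all $\varphi(x),\psi(y)\in L(M)$. Let $M\prec\mathcal U$ be an elementary submodel, not necessarily small, and let $\mu_x,\nu_y$ be Keisler measures over $M$, where $x$ and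 $y$ are disjoint, possibly infinite, tuples of variables. Assume that $\mu$ is smooth. Then there is a unique separated amalgam of $\mu$ and $\nu$ over $M$, denoted $\mu\times\nu$. If moreover $\nu$ is smooth, then $\mu\times\nu$ is smooth. -/

import Mathlib

universe u v w

namespace FirstOrder.Language

/-- `U` is `κ`-saturated: for every parameter set `A ⊆ U` of cardinality `< κ`, every finitely
satisfiable set of `L(A)`-formulas in finitely many variables is realized in `U`. -/
def IsSaturated (L : Language.{u, v}) (U : Type w) [L.Structure U] (κ : Cardinal.{w}) : Prop :=
  ∀ A : Set U, Cardinal.mk A < κ →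
    ∀ (n : ℕ) (p : Set (L[[A]].Formula (Fin n))),
      (∀ q : Finset (L[[A]].Formula (Fin n)), (q : Set (L[[A]].Formula (Fin n))) ⊆ p →
        ∃ a : Fin n → U, ∀ φ ∈ q, φ.Realize a) →
      ∃ a : Fin n → U, ∀ φ ∈ p, φ.Realize a

/-- A Keisler measure over `A ⊆ U` in the tuple of variables indexed by `α`: a finitely additive
probability measure on the Boolean algebra of `A`-definable subsets of `α → U`. -/
@[ext]
structure KeislerMeasure (L : Language.{u, v}) {U : Type w} [L.Structure U] (A : Set U)
    (α : Type*) where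
  toFun : L.DefinableSet A α → ℝ
  nonneg' : ∀ s, 0 ≤ toFun s
  top' : toFun ⊤ = 1
  sup' : ∀ s t, Disjoint s t → toFun (s ⊔ t) = toFun s + toFun t

/-- An `A`-definable set, seen as a `B`-definable set for `A ⊆ B`. -/
def DefinableSet.ofSubset {L : Language.{u, v}} {U : Type w} [L.Structure U] {A B : Set U}
    {α : Type*} (h : A ⊆ B) (s : L.DefinableSet A α) : L.DefinableSet B α :=
  ⟨s.1, s.2.mono h⟩

/-- The set of pairs `(x, y)` with `x ∈ s` and `y ∈ t`: if `φ(x)` and `ψ(y)` define `s` and `t`,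
this is the set defined by `φ(x) ∧ ψ(y)`. -/
def DefinableSet.rectangle {L : Language.{u, v}} {U : Type w} [L.Structure U] {A : Set U}
    {α β : Type*} (s : L.DefinableSet A α) (t : L.DefinableSet A β) :
    L.DefinableSet A (α ⊕ β) :=
  ⟨{z | z ∘ Sum.inl ∈ s ∧ z ∘ Sum.inr ∈ t},
    (s.2.preimage_comp Sum.inl).inter (t.2.preimage_comp Sum.inr)⟩

namespace KeislerMeasure

variable {L : Language.{u, v}} {U : Type w} [L.Structure U]

instance {A : Set U} {α : Type*} :
    CoeFun (KeislerMeasure L A α) (fun _ => L.DefinableSet A α → ℝ) :=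
  ⟨KeislerMeasure.toFun⟩

/-- The restriction to `A` of a Keisler measure over `B ⊇ A`. -/
def restrict {A B : Set U} {α : Type*} (h : A ⊆ B) (μ : KeislerMeasure L B α) :
    KeislerMeasure L A α where
  toFun s := μ (s.ofSubset h)
  nonneg' _ := μ.nonneg' _
  top' := μ.top'
  sup' s t hst := by
    refine μ.sup' (s.ofSubset h) (t.ofSubset h) ?_
    rw [disjoint_iff] at hst ⊢
    exact SetLike.coe_injective (congrArg (fun r : L.DefinableSet A α => (r : Set (α → U))) hst)

/-- `μ` has exactly one extension to a global Keisler measure, i.e. one over all of `U`. -/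
def HasUniqueGlobalExtension {A : Set U} {α : Type*} (μ : KeislerMeasure L A α) : Prop :=
  ∃! μ' : KeislerMeasure L (Set.univ : Set U) α, μ'.restrict (Set.subset_univ A) = μ

/-- Smoothness of a measure over an elementary submodel `M` of `U`, which need not be small (small
means of cardinality `< κ`). For small `M` it means that `μ` has a unique global extension
(see `isSmooth_iff_of_small`). For large `M` that condition alone would be too weak, and void for
`M = U`: there, `μ` is smooth if moreover its restriction to some small elementary submodel `M₀`
contained in `M` has a unique global extension. -/
def IsSmooth (κ : Cardinal.{w}) {M : L.ElementarySubstructure U} {α : Type*}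
    (μ : KeislerMeasure L (M : Set U) α) : Prop :=
  μ.HasUniqueGlobalExtension ∧
    ∃ (M₀ : L.ElementarySubstructure U) (h : (M₀ : Set U) ⊆ (M : Set U)),
      Cardinal.mk M₀ < κ ∧ (μ.restrict h).HasUniqueGlobalExtension

theorem isSmooth_iff_of_small {κ : Cardinal.{w}} {M : L.ElementarySubstructure U}
    (hM : Cardinal.mk M < κ) {α : Type*} (μ : KeislerMeasure L (M : Set U) α) :
    μ.IsSmooth κ ↔ μ.HasUniqueGlobalExtension :=
  ⟨fun h => h.1, fun h => ⟨h, M, subset_rfl, hM, h⟩⟩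

/-- `ω` is a separated amalgam of `μ` and `ν`: `ω(φ(x) ∧ ψ(y)) = μ(φ(x)) ν(ψ(y))`. -/
def IsSeparatedAmalgam {A : Set U} {α β : Type*} (μ : KeislerMeasure L A α)
    (ν : KeislerMeasure L A β) (ω : KeislerMeasure L A (α ⊕ β)) : Prop :=
  ∀ (s : L.DefinableSet A α) (t : L.DefinableSet A β), ω (s.rectangle t) = μ s * ν t

end KeislerMeasure

end FirstOrder.Language

/-! Existence: integrating in `x` and then in `y` shows that the product functional is positive on
combinations of rectangles, and Hahn–Banach extends it to a measure (`exists_isSeparatedAmalgam`).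

Uniqueness: maximal extensions show that a unique global extension forces every definable set to be
sandwiched between sets over the base with small gap (`exists_approx`). By saturation over a small
base, finitely many pairs `(s, t)` sandwich all fibres of a given definable `E`, each pair serving a
definable set `Q` of fibres (`exists_uniform_approx`). The part of `E` over `Q` then has measure
between `μ s * ν Q` and `μ t * ν Q`. After making the sets `Q` disjoint, any two amalgams differ by
at most `ε` on `E`.

Smoothness: both small witnesses lie in one small `N` inside `M`. Sandwiching both factors shows
that every global extension of the amalgam over `N` is a separated amalgam of the global extensions,
and the uniqueness argument applies over `U` with small base `N`. -/

namespace Set.Definable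

open FirstOrder FirstOrder.Language

variable {L : FirstOrder.Language.{u, v}} {U : Type w} [L.Structure U] {A : Set U} {α β : Type*}

/-! ### Definable sets in infinitely many variables -/

/-- A definable set depends on only finitely many of its first variables. -/
theorem exists_finset_left {W : Set (α ⊕ β → U)} (hW : A.Definable L W) :
    ∃ (S : Finset α) (W' : Set (S ⊕ β → U)), A.Definable L W' ∧
      ∀ x y, Sum.elim x y ∈ W ↔ Sum.elim (fun a : S => x a) y ∈ W' := by
  classical
  obtain ⟨φ, rfl⟩ := hW
  refine ⟨φ.freeVarFinset.toLeft, _, ⟨φ.restrictFreeVar fun x => Sum.casesOn x.1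
    (fun a ha => Sum.inl ⟨a, by simpa using ha⟩) (fun b _ => Sum.inr b) x.2, rfl⟩, fun x y => ?_⟩
  simp only [Formula.Realize, mem_ofPred_eq]
  refine (BoundedFormula.realize_restrictFreeVar _ ?_).symm
  rintro ⟨a | b, h⟩ <;> rfl

/-- A definable set depends on only finitely many of its last variables. -/
theorem exists_finset_right {W : Set (α ⊕ β → U)} (hW : A.Definable L W) :
    ∃ (S : Finset β) (W' : Set (α ⊕ S → U)), A.Definable L W' ∧
      ∀ x y, Sum.elim x y ∈ W ↔ Sum.elim x (fun b : S => y b) ∈ W' := by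
  obtain ⟨S, W', hW', h⟩ := (hW.preimage_comp (Sum.swap : α ⊕ β → β ⊕ α)).exists_finset_left
  refine ⟨S, _, hW'.preimage_comp (Sum.swap : S ⊕ α → α ⊕ S), fun x y => ?_⟩
  have := h y x
  simpa only [Set.mem_preimage, Sum.elim_swap] using this

/-- Universal quantification over a tuple of arbitrary length preserves definability. -/
theorem forall_left [Nonempty (α → U)] {W : Set (α ⊕ β → U)} (hW : A.Definable L W) :
    A.Definable L {y : β → U | ∀ x : α → U, Sum.elim x y ∈ W} := by
  classical
  obtain ⟨S, W', hW', h⟩ := hW.exists_finset_left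
  have hW'' := (hW'.preimage_comp (Sum.swap : S ⊕ β → β ⊕ S)).forall_of_finite
  convert! hW'' using 1
  ext y
  simp only [Set.mem_ofPred_eq, Set.mem_preimage, Sum.elim_swap, h]
  refine ⟨fun hx u => ?_, fun hu x => hu _⟩
  -- `x₀` fills the coordinates outside `S`. If `α → U` were empty, the quantifier over it would be
  -- vacuous while that over `S → U` need not be.
  obtain ⟨x₀⟩ := ‹Nonempty (α → U)›
  simpa using hx fun a => if ha : a ∈ S then u ⟨a, ha⟩ else x₀ a

/-- The fibres of a definable set are definable over the whole structure. -/
theorem fiber {W : Set (α ⊕ β → U)} (hW : A.Definable L W) (y : β → U) :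
    (Set.univ : Set U).Definable L {x : α → U | Sum.elim x y ∈ W} := by
  rw [definable_iff_exists_formula_sum] at hW ⊢
  obtain ⟨φ, rfl⟩ := hW
  refine ⟨φ.relabel (Sum.elim (fun a : A => Sum.inl ⟨a, Set.mem_univ _⟩)
    (Sum.elim Sum.inr fun b => Sum.inl ⟨y b, Set.mem_univ _⟩)), ?_⟩
  ext x
  simp only [Set.mem_ofPred_eq, Formula.realize_relabel]
  refine iff_of_eq (congrArg _ ?_)
  ext (a | a | b) <;> rfl

end Set.Definable

/-! ### Saturation and small elementary substructures -/

namespace FirstOrder.Language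

variable {L : Language.{u, v}} {U : Type w} [L.Structure U]

/-- In a saturated structure, a cover by sets that are definable over a common small parameter set
has a finite subcover. -/
theorem IsSaturated.exists_finset_cover {κ : Cardinal.{w}} (hU : L.IsSaturated U κ) {A : Set U}
    (hA : Cardinal.mk A < κ) {τ : Type*} [Finite τ] {K : Type*} {Q : K → Set (τ → U)}
    (hQ : ∀ k, A.Definable L (Q k)) (hcover : ∀ y, ∃ k, y ∈ Q k) :
    ∃ F : Finset K, ∀ y, ∃ k ∈ F, y ∈ Q k := by
  classical
  obtain ⟨n, ⟨f⟩⟩ := Finite.exists_equiv_fin τ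
  choose ψ hψ using fun k => (hQ k).preimage_comp f
  by_contra! hF
  -- Without a finite subcover, the complements form a finitely satisfiable set of formulas. A
  -- realization escapes every `Q k`.
  obtain ⟨a, ha⟩ := hU A hA n (Set.range fun k => (ψ k).not) fun q hq => by
    rw [← Set.image_univ, Finset.subset_set_image_iff] at hq
    obtain ⟨F, -, rfl⟩ := hq
    obtain ⟨y, hy⟩ := hF F
    refine ⟨y ∘ f.symm, fun φ hφ => ?_⟩
    obtain ⟨k, hk, rfl⟩ := Finset.mem_image.1 hφ
    rw [Formula.realize_not]
    intro h
    have h' : y ∘ f.symm ∈ Set.ofPred (ψ k).Realize := h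
    rw [← hψ k] at h'
    refine hy k hk ?_
    simpa [Function.comp_assoc] using h'
  obtain ⟨k, hk⟩ := hcover (a ∘ f)
  refine (Formula.realize_not.1 (ha _ ⟨k, rfl⟩)) ?_
  have h' : a ∈ (fun g : Fin n → U => g ∘ f) ⁻¹' Q k := hk
  rw [hψ k] at h'
  exact h'

/-- Elementary substructures of elementary substructures are elementary. -/
theorem ElementarySubstructure.exists_coe_eq_image (M : L.ElementarySubstructure U)
    (S : L.ElementarySubstructure M) :
    ∃ N : L.ElementarySubstructure U, (N : Set U) = Subtype.val '' (S : Set M) := by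
  let f : S ↪ₑ[L] U := M.subtype.comp S.subtype
  let e := f.toEmbedding.equivRange
  refine ⟨⟨f.toEmbedding.toHom.range, fun n φ x => ?_⟩, ?_⟩
  · have h₁ : x = e ∘ (e.symm ∘ x) := funext fun i => (e.apply_symm_apply (x i)).symm
    have h₂ : ((↑) ∘ x : Fin n → U) = f ∘ (e.symm ∘ x) := by
      conv_lhs => rw [h₁]
      rfl
    rw [h₂, f.map_formula]
    conv_rhs => rw [h₁]
    rw [StrongHomClass.realize_formula e]
  · ext x
    constructor
    · rintro ⟨y, rfl⟩
      exact ⟨y, y.2, rfl⟩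
    · rintro ⟨y, hy, rfl⟩
      exact ⟨⟨y, hy⟩, rfl⟩

/-- A small subset of an elementary substructure `M` lies in a small elementary substructure
contained in `M`. -/
theorem ElementarySubstructure.exists_small_between {κ : Cardinal.{w}}
    (hκ : Cardinal.aleph0 < κ) (hL : Cardinal.lift.{w} L.card < Cardinal.lift.{max u v} κ)
    (M : L.ElementarySubstructure U) {s : Set U} (hsM : s ⊆ M) (hs : Cardinal.mk s < κ) :
    ∃ N : L.ElementarySubstructure U, s ⊆ N ∧ (N : Set U) ⊆ M ∧ Cardinal.mk N < κ := by
  -- A small `M` serves itself; otherwise `M` is large enough for downward Löwenheim–Skolem at the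
  -- cardinal below.
  by_cases hM : Cardinal.mk M < κ
  · exact ⟨M, hsM, subset_rfl, hM⟩
  -- `c` is the cardinality of `L` brought into the universe of `κ`.
  obtain ⟨c, hc⟩ := Cardinal.mem_range_lift_of_le hL.le
  have hcκ : c < κ := by rwa [← hc, Cardinal.lift_lt] at hL
  have hlt : max Cardinal.aleph0 (max (Cardinal.mk s) c) < κ := max_lt hκ (max_lt hs hcκ)
  have hpre : Cardinal.mk (Subtype.val ⁻¹' s : Set M) ≤ Cardinal.mk s :=
    Cardinal.mk_preimage_of_injective _ _ Subtype.val_injective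
  obtain ⟨S, hS, hcard⟩ := exists_elementarySubstructure_card_eq L (Subtype.val ⁻¹' s : Set M)
    (max Cardinal.aleph0 (max (Cardinal.mk s) c)) (le_max_left _ _)
    (Cardinal.lift_le.2 (hpre.trans ((le_max_left _ _).trans (le_max_right _ _))))
    (by rw [← hc]; exact Cardinal.lift_le.2 ((le_max_right _ _).trans (le_max_right _ _)))
    (Cardinal.lift_le.2 (hlt.le.trans (not_lt.1 hM)))
  obtain ⟨N, hN⟩ := M.exists_coe_eq_image S
  refine ⟨N, fun x hx => ?_, ?_, ?_⟩
  · rw [hN]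
    exact ⟨⟨x, hsM hx⟩, hS hx, rfl⟩
  · rw [hN]
    rintro _ ⟨x, -, rfl⟩
    exact x.2
  · have : Cardinal.mk (N : Set U) = Cardinal.mk S := by
      rw [hN]; exact Cardinal.mk_image_eq Subtype.val_injective
    change Cardinal.mk (N : Set U) < κ
    rw [this]
    rw [Cardinal.lift_inj] at hcard
    rwa [hcard]

end FirstOrder.Language

/-! ### Hahn–Banach with a prescribed extremal value -/

/-- **Hahn–Banach for positive functionals.** A functional `I` on `V` that is positive with respect
to `e : V → F` induces a functional on `E`, dominated by `I` and with the largest possible value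
at `x₀`. -/
theorem exists_linearMap_le_of_nonneg {V E F : Type*} [AddCommGroup V] [Module ℝ V]
    [AddCommGroup E] [Module ℝ E] [AddCommGroup F] [PartialOrder F] [IsOrderedAddMonoid F]
    [Module ℝ F] [PosSMulMono ℝ F] (e : V →ₗ[ℝ] F) (I : V →ₗ[ℝ] ℝ) (d : E →ₗ[ℝ] F)
    (hpos : ∀ v, 0 ≤ e v → 0 ≤ I v) (hdom : ∀ x, ∃ v, d x ≤ e v) {x₀ : E} (hx₀ : x₀ ≠ 0) :
    ∃ G : E →ₗ[ℝ] ℝ, (∀ x v, d x ≤ e v → G x ≤ I v) ∧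
      ∀ ε > 0, ∃ v, d x₀ ≤ e v ∧ I v < G x₀ + ε := by
  let S : E → Set ℝ := fun x => I '' {v | d x ≤ e v}
  have hne : ∀ x, (S x).Nonempty := fun x => by
    obtain ⟨v, hv⟩ := hdom x
    exact ⟨I v, v, hv, rfl⟩
  have hbdd : ∀ x, BddBelow (S x) := fun x => by
    obtain ⟨v', hv'⟩ := hdom (-x)
    refine ⟨-I v', ?_⟩
    rintro _ ⟨v, hv, rfl⟩
    have h : 0 ≤ e (v + v') := by
      have := add_le_add (show d x ≤ e v from hv) hv'
      rwa [← map_add, ← map_add, add_neg_cancel, map_zero] at this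
    have := hpos _ h
    rw [map_add] at this
    linarith
  -- The upper integral: it is sublinear, and `G` is a functional below it that attains it at `x₀`.
  let N : E → ℝ := fun x => sInf (S x)
  have hN_le : ∀ x v, d x ≤ e v → N x ≤ I v := fun x v h => csInf_le (hbdd x) ⟨v, h, rfl⟩
  have hN_exists : ∀ x, ∀ ε > 0, ∃ v, d x ≤ e v ∧ I v < N x + ε := fun x ε hε => by
    obtain ⟨_, ⟨v, hv, rfl⟩, h⟩ := exists_lt_of_csInf_lt (hne x) (show N x < N x + ε by linarith)
    exact ⟨v, hv, h⟩
  have hN_smul_le : ∀ c : ℝ, 0 < c → ∀ x, N (c • x) ≤ c * N x := fun c hc x => by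
    refine le_of_forall_pos_lt_add fun ε hε => ?_
    obtain ⟨v, hv, h⟩ := hN_exists x (ε / c) (div_pos hε hc)
    have h' := hN_le (c • x) (c • v) (by
      rw [map_smul, map_smul]; exact smul_le_smul_of_nonneg_left hv hc.le)
    rw [map_smul, smul_eq_mul] at h'
    have h'' := mul_lt_mul_of_pos_left h hc
    rw [mul_add, mul_div_cancel₀ _ hc.ne'] at h''
    linarith
  have hN_smul : ∀ c : ℝ, 0 < c → ∀ x, N (c • x) = c * N x := fun c hc x => by
    refine le_antisymm (hN_smul_le c hc x) ?_
    have h := hN_smul_le c⁻¹ (inv_pos.2 hc) (c • x)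
    rw [smul_smul, inv_mul_cancel₀ hc.ne', one_smul] at h
    rwa [← le_inv_mul_iff₀ hc]
  have hN_add : ∀ x y, N (x + y) ≤ N x + N y := fun x y => by
    refine le_of_forall_pos_lt_add fun ε hε => ?_
    obtain ⟨v, hv, h⟩ := hN_exists x (ε / 2) (half_pos hε)
    obtain ⟨v', hv', h'⟩ := hN_exists y (ε / 2) (half_pos hε)
    have h'' := hN_le (x + y) (v + v') (by rw [map_add, map_add]; exact add_le_add hv hv')
    rw [map_add] at h''
    linarith
  have hN_zero : N 0 = 0 := by
    have h := hN_smul 2 two_pos 0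
    rw [smul_zero] at h
    linarith
  obtain ⟨G, hG, hGN⟩ := exists_extension_of_le_sublinear
    (LinearPMap.mkSpanSingleton (σ := RingHom.id ℝ) x₀ (N x₀) hx₀) N hN_smul hN_add (by
      rintro ⟨x, hx⟩
      obtain ⟨c, rfl⟩ := Submodule.mem_span_singleton.1 hx
      rw [LinearPMap.mkSpanSingleton'_apply]
      simp only [RingHom.id_apply, smul_eq_mul]
      rcases lt_trichotomy c 0 with hc | rfl | hc
      -- For negative `c`, subadditivity gives `0 = N 0 ≤ N (c • x₀) + N (-c • x₀)`.
      · have h₁ := hN_smul (-c) (neg_pos.2 hc) x₀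
        have h₂ := hN_add (c • x₀) ((-c) • x₀)
        rw [← add_smul, add_neg_cancel, zero_smul, hN_zero] at h₂
        linarith
      · simp [hN_zero]
      · exact (hN_smul c hc x₀).ge)
  have hGx₀ : G x₀ = N x₀ := by
    rw [← LinearPMap.mkSpanSingleton_apply ℝ ℝ hx₀ (N x₀)]
    exact hG ⟨x₀, Submodule.mem_span_singleton_self x₀⟩
  refine ⟨G, fun x v h => (hGN x).trans (hN_le x v h), fun ε hε => ?_⟩
  rw [hGx₀]
  exact hN_exists x₀ ε hε

/-! ### Simple functions and their integrals -/

namespace FirstOrder.Language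

variable {L : Language.{u, v}} {U : Type w} [L.Structure U] {A B : Set U} {α β : Type*}

namespace DefinableSet

theorem mem_rectangle {s : L.DefinableSet A α} {t : L.DefinableSet A β} {z : α ⊕ β → U} :
    z ∈ s.rectangle t ↔ z ∘ Sum.inl ∈ s ∧ z ∘ Sum.inr ∈ t :=
  Iff.rfl

theorem le_of_forall_mem {s t : L.DefinableSet A α} (h : ∀ x ∈ s, x ∈ t) : s ≤ t := h

/-- The indicator function of a definable set. -/
noncomputable def indicator (s : L.DefinableSet A α) : (α → U) → ℝ :=
  (s : Set (α → U)).indicator 1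

theorem indicator_of_mem {s : L.DefinableSet A α} {x : α → U} (h : x ∈ s) : s.indicator x = 1 :=
  Set.indicator_of_mem (s := (s : Set (α → U))) h 1

theorem indicator_of_notMem {s : L.DefinableSet A α} {x : α → U} (h : x ∉ s) :
    s.indicator x = 0 :=
  Set.indicator_of_notMem (s := (s : Set (α → U))) h 1

theorem indicator_nonneg (s : L.DefinableSet A α) (x : α → U) : 0 ≤ s.indicator x := by
  by_cases h : x ∈ s
  · rw [indicator_of_mem h]; exact zero_le_one
  · rw [indicator_of_notMem h]

theorem indicator_le_one (s : L.DefinableSet A α) (x : α → U) : s.indicator x ≤ 1 := by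
  by_cases h : x ∈ s
  · rw [indicator_of_mem h]
  · rw [indicator_of_notMem h]; exact zero_le_one

theorem indicator_top : (⊤ : L.DefinableSet A α).indicator = 1 :=
  funext fun _ => indicator_of_mem mem_top

theorem indicator_sup {s t : L.DefinableSet A α} (h : Disjoint s t) :
    (s ⊔ t).indicator = s.indicator + t.indicator := by
  ext x
  have hx : ¬ (x ∈ s ∧ x ∈ t) := by
    rw [← mem_inf, h.eq_bot]
    exact notMem_bot
  rw [Pi.add_apply]
  by_cases hs : x ∈ s
  · have ht : x ∉ t := fun ht => hx ⟨hs, ht⟩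
    rw [indicator_of_mem (mem_sup.2 (Or.inl hs)), indicator_of_mem hs, indicator_of_notMem ht,
      add_zero]
  · by_cases ht : x ∈ t
    · rw [indicator_of_mem (mem_sup.2 (Or.inr ht)), indicator_of_notMem hs, indicator_of_mem ht,
        zero_add]
    · rw [indicator_of_notMem (mt mem_sup.1 (by tauto)), indicator_of_notMem hs,
        indicator_of_notMem ht, zero_add]

/-- The simple function attached to a formal linear combination of definable sets. -/
noncomputable def simpleFunction : (L.DefinableSet A α →₀ ℝ) →ₗ[ℝ] (α → U) → ℝ :=
  Finsupp.linearCombination ℝ indicator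

@[simp]
theorem simpleFunction_single (s : L.DefinableSet A α) (c : ℝ) :
    simpleFunction (Finsupp.single s c) = c • s.indicator :=
  Finsupp.linearCombination_single ℝ c s

/-- The level sets of a simple function are definable. -/
theorem definable_simpleFunction_preimage (v : L.DefinableSet A α →₀ ℝ) (Q : Set ℝ) :
    A.Definable L {x | simpleFunction v x ∈ Q} := by
  induction v using Finsupp.induction generalizing Q with
  | zero =>
    by_cases h : (0 : ℝ) ∈ Q
    · simp [h, Set.ofPred_true]
    · simp [h, Set.ofPred_false]
  | single_add s c v _ _ ih =>
    convert! (s.2.inter (ih {r | c + r ∈ Q})).union (s.2.compl.inter (ih Q)) using 1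
    ext x
    by_cases h : x ∈ s
    · have h' : x ∈ s.1 := h
      simp [indicator_of_mem h, h']
    · have h' : x ∉ s.1 := h
      simp [indicator_of_notMem h, h']

end DefinableSet

namespace KeislerMeasure

open DefinableSet

variable (μ : KeislerMeasure L A α)

theorem apply_bot : μ ⊥ = 0 := by
  have h := μ.sup' ⊥ ⊥ disjoint_bot_left
  rw [sup_idem] at h
  linarith

theorem apply_inf_add_apply_sdiff (s t : L.DefinableSet A α) : μ (s ⊓ t) + μ (s \ t) = μ s := by
  rw [← μ.sup' _ _ disjoint_inf_sdiff, sup_inf_sdiff]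

theorem apply_mono {s t : L.DefinableSet A α} (h : s ≤ t) : μ s ≤ μ t := by
  have h₁ := μ.apply_inf_add_apply_sdiff t s
  rw [inf_eq_right.2 h] at h₁
  linarith [μ.nonneg' (t \ s)]

theorem apply_sdiff {s t : L.DefinableSet A α} (h : s ≤ t) : μ (t \ s) = μ t - μ s := by
  have h₁ := μ.apply_inf_add_apply_sdiff t s
  rw [inf_eq_right.2 h] at h₁
  linarith

theorem apply_add_apply_compl (s : L.DefinableSet A α) : μ s + μ sᶜ = 1 := by
  rw [← μ.sup' _ _ disjoint_compl_right, sup_compl_eq_top, μ.top']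

theorem apply_le_one (s : L.DefinableSet A α) : μ s ≤ 1 :=
  μ.top' ▸ μ.apply_mono le_top

/-- Supplies the nonemptiness needed by `Set.Definable.forall_left`. -/
theorem nonempty_tuple (μ : KeislerMeasure L A α) : Nonempty (α → U) := by
  by_contra h
  have h₁ : (⊤ : L.DefinableSet A α) = ⊥ :=
    SetLike.ext fun x => (h ⟨x⟩).elim
  have h₂ := μ.top'
  rw [h₁, apply_bot] at h₂
  exact zero_ne_one h₂

/-- The integral of a simple function, as a functional on formal linear combinations. -/
noncomputable def integral : (L.DefinableSet A α →₀ ℝ) →ₗ[ℝ] ℝ :=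
  Finsupp.linearCombination ℝ μ

@[simp]
theorem integral_single (s : L.DefinableSet A α) (c : ℝ) :
    μ.integral (Finsupp.single s c) = c * μ s :=
  Finsupp.linearCombination_single ℝ c s

/-- Positivity of the integral, localized to `t` so that induction works: adding `b` times the
indicator of `s` cuts `t` along `s` and lowers the bound to `c - b` on `t ⊓ s`. -/
theorem mul_apply_le_of_le_simpleFunction (v : L.DefinableSet A α →₀ ℝ) (c : ℝ)
    (t : L.DefinableSet A α) (h : ∀ x ∈ t, c ≤ simpleFunction v x) :
    c * μ t ≤ Finsupp.linearCombination ℝ (fun s => μ (s ⊓ t)) v := by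
  induction v using Finsupp.induction generalizing c t with
  | zero =>
    simp only [map_zero, Pi.zero_apply] at h ⊢
    by_cases ht : ∃ x, x ∈ t
    · obtain ⟨x, hx⟩ := ht
      exact mul_nonpos_of_nonpos_of_nonneg (h x hx) (μ.nonneg' t)
    · have : t = ⊥ := SetLike.ext fun x => ⟨fun hx => (ht ⟨x, hx⟩).elim, fun hx => hx.elim⟩
      rw [this, apply_bot, mul_zero]
  | single_add s b v _ _ ih =>
    have h₁ := ih (c - b) (t ⊓ s) fun x hx => by
      have := h x (mem_inf.1 hx).1
      simp only [map_add, simpleFunction_single, Pi.add_apply, Pi.smul_apply,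
        indicator_of_mem (mem_inf.1 hx).2, smul_eq_mul, mul_one] at this
      linarith
    have h₂ := ih c (t \ s) fun x hx => by
      have := h x (mem_sdiff.1 hx).1
      simp only [map_add, simpleFunction_single, Pi.add_apply, Pi.smul_apply,
        indicator_of_notMem (mem_sdiff.1 hx).2, smul_eq_mul, mul_zero] at this
      linarith
    have h₃ : Finsupp.linearCombination ℝ (fun r => μ (r ⊓ (t ⊓ s))) v +
        Finsupp.linearCombination ℝ (fun r => μ (r ⊓ (t \ s))) v =
        Finsupp.linearCombination ℝ (fun r => μ (r ⊓ t)) v := by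
      simp only [Finsupp.linearCombination_apply]
      rw [← Finsupp.sum_add]
      refine Finsupp.sum_congr fun r _ => ?_
      rw [← smul_add, ← inf_assoc, ← inf_sdiff_assoc, apply_inf_add_apply_sdiff]
    have h₄ := μ.apply_inf_add_apply_sdiff t s
    rw [map_add, Finsupp.linearCombination_single, ← h₃, smul_eq_mul, inf_comm s t, ← h₄]
    linarith

theorem integral_nonneg (v : L.DefinableSet A α →₀ ℝ) (h : 0 ≤ simpleFunction v) :
    0 ≤ μ.integral v := by
  have := μ.mul_apply_le_of_le_simpleFunction v 0 ⊤ fun x _ => h x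
  simp only [zero_mul, inf_top_eq] at this
  exact this

/-! ### Extensions, approximation and existence of amalgams -/

/-- A positive normalized functional `I` on a space of functions (the range of `e`) is induced by a
Keisler measure, which can be chosen with the largest possible value at a given set `D`. -/
theorem exists_of_positive {V : Type*} [AddCommGroup V] [Module ℝ V]
    (e : V →ₗ[ℝ] (α → U) → ℝ) (I : V →ₗ[ℝ] ℝ) (hpos : ∀ v, 0 ≤ e v → 0 ≤ I v)
    {o : V} (ho : e o = 1) (hIo : I o = 1) (D : L.DefinableSet A α) :
    ∃ ω : KeislerMeasure L A α, (∀ v s, e v = s.indicator → ω s = I v) ∧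
      ∀ ε > 0, ∃ v, D.indicator ≤ e v ∧ I v < ω D + ε := by
  obtain ⟨G, hG, hGD⟩ := exists_linearMap_le_of_nonneg e I
    (simpleFunction : (L.DefinableSet A α →₀ ℝ) →ₗ[ℝ] _) hpos (fun w => by
      induction w using Finsupp.induction_linear with
      | zero => exact ⟨0, by simp⟩
      | add w w' h h' =>
        obtain ⟨v, hv⟩ := h
        obtain ⟨v', hv'⟩ := h'
        exact ⟨v + v', by rw [map_add, map_add]; exact add_le_add hv hv'⟩
      | single s c =>
        refine ⟨|c| • o, fun x => ?_⟩
        rw [simpleFunction_single, map_smul, ho]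
        simp only [Pi.smul_apply, smul_eq_mul, Pi.one_apply]
        exact mul_le_mul (le_abs_self c) (s.indicator_le_one x) (s.indicator_nonneg x)
          (abs_nonneg c)) (x₀ := Finsupp.single D 1) (by simp)
  -- Domination applied to both signs gives equality.
  have hG' : ∀ w v, simpleFunction w = e v → G w = I v := fun w v h => by
    refine le_antisymm (hG w v h.le) ?_
    have := hG (-w) (-v) (by rw [map_neg, map_neg, h])
    rw [map_neg, map_neg] at this
    linarith
  refine ⟨⟨fun s => G (Finsupp.single s 1), fun s => ?_, ?_, fun s t hst => ?_⟩,
    fun v s h => hG' _ _ (by rw [h, simpleFunction_single, one_smul]), fun ε hε => ?_⟩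
  · have := hG (-Finsupp.single s 1) 0 (fun x => by
      simpa using s.indicator_nonneg x)
    simpa using this
  · rw [hG' _ o (by rw [ho, simpleFunction_single, one_smul, indicator_top]), hIo]
  · have := hG' (Finsupp.single (s ⊔ t) 1 - (Finsupp.single s 1 + Finsupp.single t 1)) 0 (by
      simp [indicator_sup hst])
    rw [map_sub, map_add, map_zero] at this
    linarith
  · obtain ⟨v, hv, h⟩ := hGD ε hε
    exact ⟨v, by simpa using hv, h⟩

/-- Every Keisler measure extends to any larger parameter set, and the extension can be chosen with the largest possible
value at a given set `D`. -/
theorem exists_extension (h : A ⊆ B) (D : L.DefinableSet B α) :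
    ∃ μ' : KeislerMeasure L B α, μ'.restrict h = μ ∧
      ∀ ε > 0, ∃ v, D.indicator ≤ simpleFunction v ∧ μ.integral v < μ' D + ε := by
  obtain ⟨ω, hω, hωD⟩ := exists_of_positive simpleFunction μ.integral μ.integral_nonneg
    (o := Finsupp.single ⊤ 1) (by simp [indicator_top]) (by simp [μ.top']) D
  refine ⟨ω, ?_, hωD⟩
  ext s
  have := hω (Finsupp.single s 1) (s.ofSubset h) (by
    rw [simpleFunction_single, one_smul]; rfl)
  rw [integral_single, one_mul] at this
  exact this

/-- If `μ` has a unique global extension, every definable set is approximated from inside and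
outside by sets that are definable over the parameters of `μ`. -/
theorem HasUniqueGlobalExtension.exists_approx {μ : KeislerMeasure L A α}
    (hμ : μ.HasUniqueGlobalExtension) (D : L.DefinableSet (Set.univ : Set U) α) {ε : ℝ}
    (hε : 0 < ε) :
    ∃ s t : L.DefinableSet A α, (∀ x ∈ s, x ∈ D) ∧ (∀ x ∈ D, x ∈ t) ∧ μ t - μ s < ε := by
  obtain ⟨μ₁, h₁, h₁D⟩ := μ.exists_extension (Set.subset_univ A) D
  obtain ⟨μ₂, h₂, h₂D⟩ := μ.exists_extension (Set.subset_univ A) Dᶜ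
  -- The extension maximal at `D` is also the one maximal at `Dᶜ`, so the integrals of the majorants
  -- `v` and `w` add up to less than `1 + ε`.
  obtain rfl := hμ.unique h₁ h₂
  obtain ⟨v, hv, hv'⟩ := h₁D (ε / 2) (half_pos hε)
  obtain ⟨w, hw, hw'⟩ := h₂D (ε / 2) (half_pos hε)
  have hsum := μ₁.apply_add_apply_compl D
  let t : L.DefinableSet A α := ⟨_, definable_simpleFunction_preimage v (Set.Ici 1)⟩
  let r : L.DefinableSet A α := ⟨_, definable_simpleFunction_preimage w (Set.Ici 1)⟩
  have hDt : ∀ x ∈ D, x ∈ t := fun x hx => by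
    have := hv x
    rwa [indicator_of_mem hx] at this
  have hDr : ∀ x ∉ D, x ∈ r := fun x hx => by
    have := hw x
    rwa [indicator_of_mem (mem_compl.2 hx)] at this
  have hrD : ∀ x ∈ rᶜ, x ∈ D := fun x hx => by
    by_contra h
    exact mem_compl.1 hx (hDr x h)
  refine ⟨rᶜ, t, hrD, hDt, ?_⟩
  rw [← μ.apply_sdiff (le_of_forall_mem fun x hx => hDt x (hrD x hx))]
  -- Pointwise, `v + w` is at least `1`, and at least `2` where both reach `1`, which is `t \ rᶜ`.
  -- Integrating bounds the measure of this gap by the excess over `1`.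
  have key := μ.integral_nonneg
    (v + w - Finsupp.single ⊤ 1 - Finsupp.single (t \ rᶜ) 1) fun x => by
      have hvx := hv x
      have hwx := hw x
      simp only [map_sub, map_add, simpleFunction_single, one_smul, indicator_top, Pi.sub_apply,
        Pi.add_apply, Pi.one_apply, Pi.zero_apply]
      by_cases hx : x ∈ t \ rᶜ
      · have hxt : 1 ≤ simpleFunction v x := (mem_sdiff.1 hx).1
        have hxr : 1 ≤ simpleFunction w x := by
          by_contra h
          exact (mem_sdiff.1 hx).2 (mem_compl.2 h)
        rw [indicator_of_mem hx]
        linarith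
      · rw [indicator_of_notMem hx]
        by_cases hD : x ∈ D
        · rw [indicator_of_mem hD] at hvx
          rw [indicator_of_notMem (mt mem_compl.1 (not_not.2 hD))] at hwx
          linarith
        · rw [indicator_of_notMem hD] at hvx
          rw [indicator_of_mem (mem_compl.2 hD)] at hwx
          linarith
  simp only [map_sub, map_add, integral_single, one_mul, μ.top'] at key
  linarith

/-- Two Keisler measures over the same set always have a separated amalgam. -/
theorem exists_isSeparatedAmalgam (ν : KeislerMeasure L A β) :
    ∃ ω : KeislerMeasure L A (α ⊕ β), μ.IsSeparatedAmalgam ν ω := by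
  let e : (L.DefinableSet A α × L.DefinableSet A β →₀ ℝ) →ₗ[ℝ] (α ⊕ β → U) → ℝ :=
    Finsupp.linearCombination ℝ fun p => (p.1.rectangle p.2).indicator
  let I : (L.DefinableSet A α × L.DefinableSet A β →₀ ℝ) →ₗ[ℝ] ℝ :=
    Finsupp.linearCombination ℝ fun p => μ p.1 * ν p.2
  have hrect : ∀ (s : L.DefinableSet A α) (t : L.DefinableSet A β) (x : α → U) (y : β → U),
      (s.rectangle t).indicator (Sum.elim x y) = s.indicator x * t.indicator y := fun s t x y => by
    by_cases hx : x ∈ s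
    · by_cases hy : y ∈ t
      · rw [indicator_of_mem hx, indicator_of_mem hy, one_mul, indicator_of_mem]
        exact mem_rectangle.2 ⟨hx, hy⟩
      · rw [indicator_of_notMem hy, mul_zero, indicator_of_notMem]
        exact fun h => hy (mem_rectangle.1 h).2
    · rw [indicator_of_notMem hx, zero_mul, indicator_of_notMem]
      exact fun h => hx (mem_rectangle.1 h).1
  have hpos : ∀ v, 0 ≤ e v → 0 ≤ I v := fun v hv => by
    -- Fubini: integrate in `x` for fixed `y`, then in `y`.
    have h₁ : ∀ y, 0 ≤ v.sum fun p c => c * (μ p.1 * p.2.indicator y) := fun y => by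
      have := μ.integral_nonneg (v.sum fun p c => Finsupp.single p.1 (c * p.2.indicator y))
        fun x => by
          have := hv (Sum.elim x y)
          simp only [e, Finsupp.linearCombination_apply, Finsupp.sum, Finset.sum_apply,
            Pi.smul_apply, hrect, smul_eq_mul, Pi.zero_apply] at this
          simp only [Finsupp.sum, map_sum, simpleFunction_single, Finset.sum_apply,
            Pi.smul_apply, smul_eq_mul, Pi.zero_apply]
          exact this.trans_eq (Finset.sum_congr rfl fun p _ => by ring)
      simp only [map_finsuppSum, integral_single] at this
      exact this.trans_eq (Finset.sum_congr rfl fun p _ => by ring)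
    have h₂ := ν.integral_nonneg (v.sum fun p c => Finsupp.single p.2 (c * μ p.1)) fun y => by
      simp only [Finsupp.sum, map_sum, simpleFunction_single, Finset.sum_apply,
        Pi.smul_apply, smul_eq_mul, Pi.zero_apply]
      exact (h₁ y).trans_eq (Finset.sum_congr rfl fun p _ => by ring)
    simp only [map_finsuppSum, integral_single] at h₂
    simp only [I, Finsupp.linearCombination_apply, smul_eq_mul]
    exact h₂.trans_eq (Finset.sum_congr rfl fun p _ => by ring)
  obtain ⟨ω, hω, -⟩ := exists_of_positive e I hpos (o := Finsupp.single (⊤, ⊤) 1)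
    (by
      simp only [e, Finsupp.linearCombination_single, one_smul]
      ext z
      exact indicator_of_mem (mem_rectangle.2 ⟨mem_top, mem_top⟩))
    (by simp [I, μ.top', ν.top']) (⊤ : L.DefinableSet A (α ⊕ β))
  refine ⟨ω, fun s t => ?_⟩
  rw [hω (Finsupp.single (s, t) 1) _ (by simp [e])]
  simp [I]

end KeislerMeasure

end FirstOrder.Language

/-! ### Uniform approximation and uniqueness of amalgams -/

namespace FirstOrder.Language.KeislerMeasure

open DefinableSet

variable {L : Language.{u, v}} {U : Type w} [L.Structure U] {A B : Set U} {α β : Type*}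

/-- If `μ` over a small set has a unique global extension, the fibres of a definable set are
approximated by finitely many pairs of sets, each pair serving a definable set of fibres. -/
theorem HasUniqueGlobalExtension.exists_uniform_approx {κ : Cardinal.{w}}
    (hκ : Cardinal.aleph0 < κ) (hU : L.IsSaturated U κ) (hAB : A ⊆ B) (hA : Cardinal.mk A < κ)
    {μ : KeislerMeasure L A α} (hμ : μ.HasUniqueGlobalExtension)
    (E : L.DefinableSet B (α ⊕ β)) {ε : ℝ} (hε : 0 < ε) :
    ∃ (F : Finset (L.DefinableSet A α × L.DefinableSet A α))
      (Q : L.DefinableSet A α × L.DefinableSet A α → L.DefinableSet B β),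
      (∀ k ∈ F, μ k.2 - μ k.1 < ε) ∧ (∀ y, ∃ k ∈ F, y ∈ Q k) ∧
        ∀ k, ∀ y ∈ Q k, ∀ x, (x ∈ k.1 → Sum.elim x y ∈ E) ∧ (Sum.elim x y ∈ E → x ∈ k.2) := by
  classical
  have := μ.nonempty_tuple
  -- Saturation needs a small parameter set and finitely many variables: `E` uses a finite `C`, and
  -- finitely many coordinates `R` of `y`.
  obtain ⟨C, hCB, hC⟩ := Set.definable_iff_finitely_definable.1 E.2
  obtain ⟨R, E', hE', hEE'⟩ := hC.exists_finset_right
  have hAC : Cardinal.mk (A ∪ C : Set U) < κ :=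
    (Cardinal.mk_union_le _ _).trans_lt
      (Cardinal.add_lt_of_lt hκ.le hA ((Cardinal.lt_aleph0_of_finite C).trans hκ))
  -- The `y` whose fibre lies between `k.1` and `k.2`, both implications being written as unions.
  have hQ : ∀ k : L.DefinableSet A α × L.DefinableSet A α, (A ∪ C : Set U).Definable L
      {y : R → U | ∀ x : α → U, Sum.elim x y ∈
        (((fun z => z ∘ Sum.inl) ⁻¹' (k.1 : Set (α → U)))ᶜ ∪ E') ∩
          (E'ᶜ ∪ (fun z => z ∘ Sum.inl) ⁻¹' (k.2 : Set (α → U)))} := fun k => by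
    have hE'' := hE'.mono (Set.subset_union_right : (C : Set U) ⊆ A ∪ C)
    have hk : ∀ s : L.DefinableSet A α, (A ∪ C : Set U).Definable L
        ((fun z : α ⊕ R → U => z ∘ Sum.inl) ⁻¹' (s : Set (α → U))) := fun s =>
      (s.2.preimage_comp Sum.inl).mono Set.subset_union_left
    exact (((hk k.1).compl.union hE'').inter (hE''.compl.union (hk k.2))).forall_left
  have hmem : ∀ (k : L.DefinableSet A α × L.DefinableSet A α) (y : R → U),
      (∀ x : α → U, Sum.elim x y ∈
        (((fun z => z ∘ Sum.inl) ⁻¹' (k.1 : Set (α → U)))ᶜ ∪ E') ∩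
          (E'ᶜ ∪ (fun z => z ∘ Sum.inl) ⁻¹' (k.2 : Set (α → U)))) ↔
      ∀ x, (x ∈ k.1 → Sum.elim x y ∈ E') ∧ (Sum.elim x y ∈ E' → x ∈ k.2) := fun k y => by
    simp only [Set.mem_inter_iff, Set.mem_union, Set.mem_compl_iff, Set.mem_preimage,
      Sum.elim_comp_inl, SetLike.mem_coe, imp_iff_not_or]
  obtain ⟨F, hF⟩ := hU.exists_finset_cover hAC
    (K := {k : L.DefinableSet A α × L.DefinableSet A α // μ k.2 - μ k.1 < ε})
    (fun k => hQ k) fun y => by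
      obtain ⟨s, t, hs, ht, hst⟩ := hμ.exists_approx ⟨_, hE'.fiber y⟩ hε
      exact ⟨⟨(s, t), hst⟩, (hmem _ y).2 fun x => ⟨hs x, ht x⟩⟩
  refine ⟨F.map (Function.Embedding.subtype _), fun k => ⟨_, ((hQ k).mono
    (Set.union_subset hAB hCB)).preimage_comp ((↑) : R → β)⟩, fun k hk => ?_, fun y => ?_,
    fun k y hy x => ?_⟩
  · obtain ⟨k', -, rfl⟩ := Finset.mem_map.1 hk
    exact k'.2
  · obtain ⟨k, hk, hy⟩ := hF (y ∘ (↑))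
    exact ⟨k, Finset.mem_map_of_mem _ hk, hy⟩
  · have h := (hmem k _).1 hy x
    exact ⟨fun hx => (hEE' x y).2 (h.1 hx), fun hx => h.2 ((hEE' x y).1 hx)⟩

/-- The comparison of two separated amalgams on a set whose fibres are uniformly approximated. -/
theorem IsSeparatedAmalgam.apply_inf_le {μ : KeislerMeasure L A α} {ν : KeislerMeasure L A β}
    {ω ω' : KeislerMeasure L A (α ⊕ β)} (hω : μ.IsSeparatedAmalgam ν ω)
    (hω' : μ.IsSeparatedAmalgam ν ω') (E : L.DefinableSet A (α ⊕ β)) {ε : ℝ} {K : Type*}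
    (F : Finset K) (s t : K → L.DefinableSet A α) (Q : K → L.DefinableSet A β)
    (hst : ∀ k ∈ F, μ (t k) - μ (s k) < ε)
    (hQ : ∀ k, ∀ y ∈ Q k, ∀ x, (x ∈ s k → Sum.elim x y ∈ E) ∧ (Sum.elim x y ∈ E → x ∈ t k))
    (T : L.DefinableSet A β) (hT : ∀ y ∈ T, ∃ k ∈ F, y ∈ Q k) :
    ω (E ⊓ rectangle ⊤ T) ≤ ω' (E ⊓ rectangle ⊤ T) + ε * ν T := by
  classical
  induction F using Finset.induction generalizing T with
  | empty =>
    have hT' : T = ⊥ := SetLike.ext fun y =>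
      ⟨fun hy => by simpa using hT y hy, fun hy => (notMem_bot hy).elim⟩
    have hE : E ⊓ rectangle ⊤ T = ⊥ := by
      refine le_bot_iff.1 (le_of_forall_mem fun z hz => ?_)
      have := (mem_rectangle.1 (mem_inf.1 hz).2).2
      rw [hT'] at this
      exact (notMem_bot this).elim
    rw [hE, hT', apply_bot, apply_bot, apply_bot, mul_zero, add_zero]
  | insert k F _ ih =>
    -- Peeling off `T ⊓ Q k` keeps the pieces disjoint, so that the errors sum to `ε * ν T`.
    have hsplit : ∀ ρ : KeislerMeasure L A (α ⊕ β), ρ (E ⊓ rectangle ⊤ (T ⊓ Q k)) +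
        ρ (E ⊓ rectangle ⊤ (T \ Q k)) = ρ (E ⊓ rectangle ⊤ T) := fun ρ => by
      rw [← ρ.apply_inf_add_apply_sdiff (E ⊓ rectangle ⊤ T) (rectangle ⊤ (Q k))]
      congr 2 <;> refine SetLike.ext fun z => ?_ <;>
        simp only [mem_inf, mem_sdiff, mem_rectangle, mem_top] <;> tauto
    have hrest := ih (fun j hj => hst j (Finset.mem_insert_of_mem hj)) (T \ Q k) fun y hy => by
      obtain ⟨j, hj, hyj⟩ := hT y (mem_sdiff.1 hy).1
      rcases Finset.mem_insert.1 hj with rfl | hj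
      · exact ((mem_sdiff.1 hy).2 hyj).elim
      · exact ⟨j, hj, hyj⟩
    have hz : ∀ z : α ⊕ β → U, Sum.elim (z ∘ Sum.inl) (z ∘ Sum.inr) = z := fun z =>
      Sum.elim_comp_inl_inr z
    have hup : ω (E ⊓ rectangle ⊤ (T ⊓ Q k)) ≤ μ (t k) * ν (T ⊓ Q k) := by
      rw [← hω]
      refine ω.apply_mono (le_of_forall_mem fun z h => ?_)
      have h₂ := (mem_rectangle.1 (mem_inf.1 h).2).2
      refine mem_rectangle.2 ⟨(hQ k _ (mem_inf.1 h₂).2 _).2 ?_, h₂⟩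
      rw [hz]
      exact (mem_inf.1 h).1
    have hlow : μ (s k) * ν (T ⊓ Q k) ≤ ω' (E ⊓ rectangle ⊤ (T ⊓ Q k)) := by
      rw [← hω']
      refine ω'.apply_mono (le_of_forall_mem fun z h => ?_)
      have h₂ := (mem_rectangle.1 h).2
      refine mem_inf.2 ⟨?_, mem_rectangle.2 ⟨mem_top, h₂⟩⟩
      rw [← hz z]
      exact (hQ k _ (mem_inf.1 h₂).2 _).1 (mem_rectangle.1 h).1
    have hgap := mul_le_mul_of_nonneg_right (hst k (Finset.mem_insert_self k F)).le
      (ν.nonneg' (T ⊓ Q k))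
    rw [← hsplit ω, ← hsplit ω', ← ν.apply_inf_add_apply_sdiff T (Q k)]
    linarith

/-- A measure whose restriction to a small set has a unique global extension has at most one
separated amalgam with any other measure. -/
theorem IsSeparatedAmalgam.unique {κ : Cardinal.{w}} (hκ : Cardinal.aleph0 < κ)
    (hU : L.IsSaturated U κ) (hAB : A ⊆ B) (hA : Cardinal.mk A < κ)
    {μ : KeislerMeasure L B α} (hμ : (μ.restrict hAB).HasUniqueGlobalExtension)
    {ν : KeislerMeasure L B β} {ω ω' : KeislerMeasure L B (α ⊕ β)}
    (hω : μ.IsSeparatedAmalgam ν ω) (hω' : μ.IsSeparatedAmalgam ν ω') : ω = ω' := by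
  ext E
  have key : ∀ {ω ω' : KeislerMeasure L B (α ⊕ β)}, μ.IsSeparatedAmalgam ν ω →
      μ.IsSeparatedAmalgam ν ω' → ω E ≤ ω' E := fun {ω ω'} hω hω' => by
    refine le_of_forall_pos_le_add fun ε hε => ?_
    obtain ⟨F, Q, hF, hcover, hQ⟩ := hμ.exists_uniform_approx hκ hU hAB hA E hε
    have h := hω.apply_inf_le hω' E F (fun k => k.1.ofSubset hAB) (fun k => k.2.ofSubset hAB) Q
      hF hQ ⊤ fun y _ => hcover y
    have htop : rectangle (⊤ : L.DefinableSet B α) (⊤ : L.DefinableSet B β) = ⊤ :=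
      SetLike.ext fun _ => by simp only [mem_rectangle, mem_top, and_self]
    rwa [htop, inf_top_eq, ν.top', mul_one] at h
  exact le_antisymm (key hω hω') (key hω' hω)

/-- The restriction of a separated amalgam is a separated amalgam of the restrictions. -/
theorem IsSeparatedAmalgam.restrict (h : A ⊆ B) {μ : KeislerMeasure L B α}
    {ν : KeislerMeasure L B β} {ω : KeislerMeasure L B (α ⊕ β)} (hω : μ.IsSeparatedAmalgam ν ω) :
    (μ.restrict h).IsSeparatedAmalgam (ν.restrict h) (ω.restrict h) :=
  fun s t => hω (s.ofSubset h) (t.ofSubset h)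

/-- If the restriction of `μ` to a smaller set has a unique global extension, so does `μ`. -/
theorem HasUniqueGlobalExtension.of_restrict (h : A ⊆ B) {μ : KeislerMeasure L B α}
    (hμ : (μ.restrict h).HasUniqueGlobalExtension) : μ.HasUniqueGlobalExtension := by
  obtain ⟨μ', hμ', -⟩ := μ.exists_extension (Set.subset_univ B) ⊤
  refine ⟨μ', hμ', fun ρ hρ => hμ.unique ?_ ?_⟩
  · rw [← hρ]; rfl
  · rw [← hμ']; rfl

/-- If `μ` and `ν` have unique global extensions `μ'` and `ν'`, every global extension of a
separated amalgam of `μ` and `ν` is a separated amalgam of `μ'` and `ν'`. -/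
theorem IsSeparatedAmalgam.of_restrict {μ' : KeislerMeasure L (Set.univ : Set U) α}
    {ν' : KeislerMeasure L (Set.univ : Set U) β} {ω' : KeislerMeasure L (Set.univ : Set U) (α ⊕ β)}
    (hμ : (μ'.restrict (Set.subset_univ A)).HasUniqueGlobalExtension)
    (hν : (ν'.restrict (Set.subset_univ A)).HasUniqueGlobalExtension)
    (hω : (μ'.restrict (Set.subset_univ A)).IsSeparatedAmalgam (ν'.restrict (Set.subset_univ A))
      (ω'.restrict (Set.subset_univ A))) :
    μ'.IsSeparatedAmalgam ν' ω' := by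
  intro D₁ D₂
  refine eq_of_forall_dist_le fun ε hε => ?_
  obtain ⟨s₁, t₁, hs₁, ht₁, h₁⟩ := hμ.exists_approx D₁ (half_pos hε)
  obtain ⟨s₂, t₂, hs₂, ht₂, h₂⟩ := hν.exists_approx D₂ (half_pos hε)
  have hA := Set.subset_univ A
  have hlow : μ' (s₁.ofSubset hA) * ν' (s₂.ofSubset hA) ≤ ω' (D₁.rectangle D₂) := by
    refine (hω s₁ s₂).ge.trans (ω'.apply_mono (le_of_forall_mem fun z hz => ?_))
    exact mem_rectangle.2 ⟨hs₁ _ (mem_rectangle.1 hz).1, hs₂ _ (mem_rectangle.1 hz).2⟩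
  have hup : ω' (D₁.rectangle D₂) ≤ μ' (t₁.ofSubset hA) * ν' (t₂.ofSubset hA) := by
    refine (ω'.apply_mono (le_of_forall_mem fun z hz => ?_)).trans (hω t₁ t₂).le
    exact mem_rectangle.2 ⟨ht₁ _ (mem_rectangle.1 hz).1, ht₂ _ (mem_rectangle.1 hz).2⟩
  have hs₁' : μ' (s₁.ofSubset hA) ≤ μ' D₁ := μ'.apply_mono (le_of_forall_mem hs₁)
  have hs₂' : ν' (s₂.ofSubset hA) ≤ ν' D₂ := ν'.apply_mono (le_of_forall_mem hs₂)
  have ht₁' : μ' D₁ ≤ μ' (t₁.ofSubset hA) := μ'.apply_mono (le_of_forall_mem ht₁)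
  have ht₂' : ν' D₂ ≤ ν' (t₂.ofSubset hA) := ν'.apply_mono (le_of_forall_mem ht₂)
  have hlow' := mul_le_mul hs₁' hs₂' (ν'.nonneg' _) (μ'.nonneg' _)
  have hup' := mul_le_mul ht₁' ht₂' (ν'.nonneg' _) (μ'.nonneg' _)
  have h₁' : μ' (t₁.ofSubset hA) - μ' (s₁.ofSubset hA) < ε / 2 := h₁
  have h₂' : ν' (t₂.ofSubset hA) - ν' (s₂.ofSubset hA) < ε / 2 := h₂
  have hgap : μ' (t₁.ofSubset hA) * ν' (t₂.ofSubset hA) -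
      μ' (s₁.ofSubset hA) * ν' (s₂.ofSubset hA) ≤ ε := by
    -- Split the gap as `(t₁ - s₁) * t₂ + s₁ * (t₂ - s₂)`, in terms of measures.
    have e₁ : (μ' (t₁.ofSubset hA) - μ' (s₁.ofSubset hA)) * ν' (t₂.ofSubset hA) ≤ ε / 2 :=
      (mul_le_of_le_one_right (by linarith) (ν'.apply_le_one _)).trans h₁'.le
    have e₂ : μ' (s₁.ofSubset hA) * (ν' (t₂.ofSubset hA) - ν' (s₂.ofSubset hA)) ≤ ε / 2 :=
      (mul_le_of_le_one_left (by linarith) (μ'.apply_le_one _)).trans h₂'.le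
    linarith
  rw [Real.dist_eq, abs_sub_le_iff]
  constructor <;> linarith

/-- A separated amalgam of measures with unique global extensions over a small set has a unique
global extension. -/
theorem IsSeparatedAmalgam.hasUniqueGlobalExtension {κ : Cardinal.{w}}
    (hκ : Cardinal.aleph0 < κ) (hU : L.IsSaturated U κ) (hA : Cardinal.mk A < κ)
    {μ : KeislerMeasure L A α} {ν : KeislerMeasure L A β} {ω : KeislerMeasure L A (α ⊕ β)}
    (hω : μ.IsSeparatedAmalgam ν ω) (hμ : μ.HasUniqueGlobalExtension)
    (hν : ν.HasUniqueGlobalExtension) : ω.HasUniqueGlobalExtension := by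
  obtain ⟨ω₀, hω₀, -⟩ := ω.exists_extension (Set.subset_univ A) ⊤
  obtain ⟨μ', rfl, -⟩ := id hμ
  obtain ⟨ν', rfl, -⟩ := id hν
  refine ⟨ω₀, hω₀, fun ρ hρ => ?_⟩
  subst hω₀
  -- Uniqueness is applied to amalgams over all of `U`; only the base `A` has to be small.
  refine IsSeparatedAmalgam.unique hκ hU (Set.subset_univ A) hA hμ
    (IsSeparatedAmalgam.of_restrict hμ hν (hρ ▸ hω)) (IsSeparatedAmalgam.of_restrict hμ hν hω)

end FirstOrder.Language.KeislerMeasure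

/-! ### The main theorem -/

open FirstOrder.Language FirstOrder.Language.KeislerMeasure in
theorem mainTheorem9 {L : FirstOrder.Language.{u, v}} {U : Type w} [L.Structure U]
    (κ : Cardinal.{w}) (hκ : Cardinal.aleph0 < κ)
    (hL : Cardinal.lift.{w} L.card < Cardinal.lift.{max u v} κ)
    (hU : L.IsSaturated U κ)
    (M : L.ElementarySubstructure U) {α : Type*} {β : Type*}
    (μ : L.KeislerMeasure (M : Set U) α) (ν : L.KeislerMeasure (M : Set U) β)
    (hμ : μ.IsSmooth κ) :
    (∃! ω : L.KeislerMeasure (M : Set U) (α ⊕ β), μ.IsSeparatedAmalgam ν ω) ∧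
      (ν.IsSmooth κ →
        ∀ ω : L.KeislerMeasure (M : Set U) (α ⊕ β),
          μ.IsSeparatedAmalgam ν ω → ω.IsSmooth κ) := by
  obtain ⟨-, M₀, hM₀, hM₀κ, hμ₀⟩ := hμ
  constructor
  · obtain ⟨ω, hω⟩ := μ.exists_isSeparatedAmalgam ν
    exact ⟨ω, hω, fun ω' hω' => IsSeparatedAmalgam.unique hκ hU hM₀ hM₀κ hμ₀ hω' hω⟩
  · rintro ⟨-, M₁, hM₁, hM₁κ, hν₁⟩ ω hω
    obtain ⟨N, hN, hNM, hNκ⟩ := M.exists_small_between hκ hL (Set.union_subset hM₀ hM₁)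
      ((Cardinal.mk_union_le _ _).trans_lt (Cardinal.add_lt_of_lt hκ.le hM₀κ hM₁κ))
    have hωN : (ω.restrict hNM).HasUniqueGlobalExtension :=
      (hω.restrict hNM).hasUniqueGlobalExtension hκ hU hNκ
        (HasUniqueGlobalExtension.of_restrict (Set.subset_union_left.trans hN) hμ₀)
        (HasUniqueGlobalExtension.of_restrict (Set.subset_union_right.trans hN) hν₁)
    exact ⟨hωN.of_restrict, N, hNM, hNκ, hωN⟩
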